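/- A finite sequence $(e_1,\dots,e_m)$ (resp. an infinite sequence $(e_1,e_2,\dots)$) of nonnegative integers is called a finite binomid index of length $m$ (resp. an infinite binomid index) if \[\sum_{i=n-k+1}^{n} e_i\ \ge\ \sum_{i=1}^{k} e_i\] for all integers $1\le k\le n\le m$ (resp. for all integers $1\le k\le n$). Every finite binomid index $\eta$ of length $k$ extends to an infinite binomid index; let $L_k(\eta)=\tilde\eta$ be the lexicographically smallest infinite binomid index that extends $\eta$. Let $\mathbb{I}_k$ be the set of finite binomid indices of length $k$, and let $\langle L_k(\mathbb{I}_k)\rangle$ be the monoid generated by $L_k(\mathbb{I}_k)$ under componentwise addition of sequences. Let $\mathbf{Atom}$ be the set of nonzero infinite binomid indices that are not a sum of two nonzero infinite binomid indices. A subset $A$ of a commutative monoid $M$ is called a basis of $M$ if $A$ generates $M$ and, for every finite sequence $(\beta_i)_{i\le n}$ of pairwise distinct elements of $A$, all nonnegative integers $m_1,\dots,m_n$ and every $1\le j\le n$, the equality $\beta_j=\sum_{i=1}^n m_i\beta_i$ implies $m_j\ge 1$. Then, for every integer $k\ge 1$, the monoid $\langle L_k(\mathbb{I}_k)\rangle$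 is finitely generated. In particular, its basis $\mathbf{Atom}\cap L_k(\mathbb{I}_k)$ is finite; that is, $\mathbf{Atom}\cap L_k(\mathbb{I}_k)$ is a basis of $\langle L_k(\mathbb{I}_k)\rangle$, it is the only one, and it is a finite set. -/

import Mathlib

namespace Binomid

/- A sequence `(e_1, e_2, …)` of nonnegative integers is represented by `η : ℕ → ℕ` with
`η i = e_{i+1}`; a finite sequence `(e_1, …, e_m)` by `ζ : Fin m → ℕ` with `ζ i = e_{i+1}`.
Addition of sequences is componentwise. -/

/-- Infinite binomid indices: for all `1 ≤ k ≤ n`,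
`e_{n-k+1} + ⋯ + e_n ≥ e_1 + ⋯ + e_k`. -/
def IsBinomid (η : ℕ → ℕ) : Prop :=
  ∀ k n : ℕ, 1 ≤ k → k ≤ n →
    ∑ i ∈ Finset.range k, η i ≤ ∑ i ∈ Finset.Ico (n - k) n, η i

/-- The set of finite binomid indices of length `m`: the inequalities of `IsBinomid` are
required for all `1 ≤ k ≤ n ≤ m`. -/
def finiteIndices (m : ℕ) : Set (Fin m → ℕ) :=
  {ζ | ∀ k n : ℕ, 1 ≤ k → k ≤ n → n ≤ m →
    ∑ i : Fin m with i.val < k, ζ i ≤ ∑ i : Fin m with n - k ≤ i.val ∧ i.val < n, ζ i}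

/-- The truncation `(e_1, …, e_m)` of an infinite sequence. -/
def trunc (m : ℕ) (η : ℕ → ℕ) : Fin m → ℕ := fun i => η i

/-- `η` is the lexicographically smallest infinite binomid index that extends `ζ`. -/
def IsLexMinExtension {m : ℕ} (ζ : Fin m → ℕ) (η : ℕ → ℕ) : Prop :=
  IsBinomid η ∧ trunc m η = ζ ∧
    ∀ θ : ℕ → ℕ, IsBinomid θ → trunc m θ = ζ → toLex η ≤ toLex θ

/-- Auxiliary: the partial sums of a binomid extension of `ζ`. -/
def extSum {m : ℕ} (ζ : Fin m → ℕ) (n : ℕ) : ℕ :=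
  if n ≤ m then ∑ i : Fin m with i.val < n, ζ i
  else (Finset.univ : Finset (Fin n)).sup fun i =>
    if _h : 0 < i.val then extSum ζ i.val + extSum ζ (n - i.val) else 0
termination_by n
decreasing_by all_goals omega

theorem extSum_of_le {m : ℕ} (ζ : Fin m → ℕ) {n : ℕ} (h : n ≤ m) :
    extSum ζ n = ∑ i : Fin m with i.val < n, ζ i := by
  rw [extSum, if_pos h]

theorem extSum_zero {m : ℕ} (ζ : Fin m → ℕ) : extSum ζ 0 = 0 := by
  rw [extSum_of_le ζ (Nat.zero_le m)]; simp

theorem extSum_add {m : ℕ} {ζ : Fin m → ℕ} (hζ : ζ ∈ finiteIndices m) (i j : ℕ) :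
    extSum ζ i + extSum ζ j ≤ extSum ζ (i + j) := by
  rcases Nat.eq_zero_or_pos i with rfl | hi
  · simp [extSum_zero]
  rcases Nat.eq_zero_or_pos j with rfl | hj
  · simp [extSum_zero]
  by_cases h : i + j ≤ m
  · have h1 := hζ j (i + j) hj (by omega) h
    rw [extSum_of_le ζ h, extSum_of_le ζ (by omega : i ≤ m), extSum_of_le ζ (by omega : j ≤ m)]
    have h2 : ∑ a : Fin m with a.val < i + j, ζ a =
        ∑ a : Fin m with a.val < i, ζ a +
          ∑ a : Fin m with i + j - j ≤ a.val ∧ a.val < i + j, ζ a := by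
      rw [← Finset.sum_union]
      · congr 1
        ext a
        simp only [Finset.mem_filter, Finset.mem_univ, true_and, Finset.mem_union]
        omega
      · rw [Finset.disjoint_left]
        intro a
        simp only [Finset.mem_filter, Finset.mem_univ, true_and]
        omega
    omega
  · rw [extSum.eq_def ζ (i + j), if_neg h]
    have h3 := Finset.le_sup (f := fun a : Fin (i + j) =>
      if _h : 0 < a.val then extSum ζ a.val + extSum ζ (i + j - a.val) else 0)
      (Finset.mem_univ (⟨i, by omega⟩ : Fin (i + j)))
    simpa [hi] using h3

theorem extSum_le {m : ℕ} (ζ : Fin m → ℕ) {n b : ℕ} (h : m < n)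
    (hb : ∀ i, 0 < i → i < n → extSum ζ i + extSum ζ (n - i) ≤ b) : extSum ζ n ≤ b := by
  rw [extSum, if_neg (by omega)]
  refine Finset.sup_le fun i _ => ?_
  split_ifs with hi
  · exact hb i.val hi i.isLt
  · exact Nat.zero_le b

theorem IsBinomid.add_le {η : ℕ → ℕ} (hη : IsBinomid η) {i j : ℕ} (hj : 0 < j) :
    ∑ a ∈ Finset.range i, η a + ∑ a ∈ Finset.range j, η a ≤
      ∑ a ∈ Finset.range (i + j), η a := by
  have h := hη j (i + j) hj (by omega)
  rw [Nat.add_sub_cancel] at h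
  have := Finset.sum_range_add_sum_Ico η (by omega : i ≤ i + j)
  omega

/-- Every finite binomid index has a lex-minimal extension. -/
theorem exists_isLexMinExtension {m : ℕ} {ζ : Fin m → ℕ} (hζ : ζ ∈ finiteIndices m) :
    ∃ η, IsLexMinExtension ζ η := by
  have hmono : Monotone (extSum ζ) := monotone_nat_of_le_succ fun n =>
    le_trans (Nat.le_add_right _ _) (extSum_add hζ n 1)
  have hsum : ∀ n, ∑ i ∈ Finset.range n, (extSum ζ (i + 1) - extSum ζ i) = extSum ζ n := by
    intro n
    rw [Finset.sum_range_tsub hmono, extSum_zero, Nat.sub_zero]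
  refine ⟨fun n => extSum ζ (n + 1) - extSum ζ n, ?_, ?_, ?_⟩
  · intro k n _ hkn
    have h1 := Finset.sum_range_add_sum_Ico
      (fun n => extSum ζ (n + 1) - extSum ζ n) (by omega : n - k ≤ n)
    beta_reduce at h1 ⊢
    rw [hsum, hsum] at h1
    rw [hsum]
    have h2 := extSum_add hζ (n - k) k
    rw [Nat.sub_add_cancel hkn] at h2
    omega
  · funext a
    change extSum ζ (a.val + 1) - extSum ζ a.val = ζ a
    have ha := a.isLt
    rw [extSum_of_le ζ (by omega : a.val + 1 ≤ m), extSum_of_le ζ (by omega : a.val ≤ m)]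
    have h1 : (Finset.univ.filter fun i : Fin m => i.val < a.val + 1) =
        insert a (Finset.univ.filter fun i : Fin m => i.val < a.val) := by
      ext i
      simp only [Finset.mem_filter, Finset.mem_univ, true_and, Finset.mem_insert, Fin.ext_iff]
      omega
    rw [h1, Finset.sum_insert (by simp)]
    omega
  · intro θ hθ hθt
    by_contra hlt
    rw [not_le] at hlt
    obtain ⟨n, hn1, hn2⟩ := hlt
    change ∀ j, j < n → θ j = extSum ζ (j + 1) - extSum ζ j at hn1
    change θ n < extSum ζ (n + 1) - extSum ζ n at hn2
    have hs : ∀ j, j ≤ n → ∑ i ∈ Finset.range j, θ i = extSum ζ j := by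
      intro j hj
      rw [← hsum j]
      refine Finset.sum_congr rfl fun i hi => hn1 i ?_
      rw [Finset.mem_range] at hi
      omega
    have hle : extSum ζ (n + 1) ≤ ∑ i ∈ Finset.range (n + 1), θ i := by
      by_cases h : n + 1 ≤ m
      · rw [extSum_of_le ζ h, ← hθt]
        refine le_of_eq ?_
        refine Finset.sum_bij (fun a _ => a.val) ?_ ?_ ?_ ?_
        · intro a ha; simpa using ha
        · intro a _ b _ hab; exact Fin.ext hab
        · intro b hb
          rw [Finset.mem_range] at hb
          exact ⟨⟨b, by omega⟩, by simpa using hb, rfl⟩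
        · intro a _; rfl
      · refine extSum_le ζ (by omega) fun i hi hin => ?_
        rw [← hs i (by omega), ← hs (n + 1 - i) (by omega)]
        have h4 := hθ.add_le (i := i) (j := n + 1 - i) (by omega)
        rwa [show i + (n + 1 - i) = n + 1 by omega] at h4
    rw [Finset.sum_range_succ, hs n le_rfl] at hle
    omega

theorem IsLexMinExtension.unique {m : ℕ} {ζ : Fin m → ℕ} {η θ : ℕ → ℕ}
    (hη : IsLexMinExtension ζ η) (hθ : IsLexMinExtension ζ θ) : η = θ :=
  toLex.injective (le_antisymm (hη.2.2 θ hθ.1 hθ.2.1) (hθ.2.2 η hη.1 hη.2.1))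

/-- The map `L_k` that sends a finite binomid index of length `k` to its lex-minimal
extension. -/
noncomputable def lexMin (k : ℕ) (ζ : finiteIndices k) : ℕ → ℕ :=
  Classical.choose (exists_isLexMinExtension ζ.2)

theorem lexMin_spec (k : ℕ) (ζ : finiteIndices k) :
    IsLexMinExtension (ζ : Fin k → ℕ) (lexMin k ζ) :=
  Classical.choose_spec (exists_isLexMinExtension ζ.2)

/-- The set of nonzero atomic (infinite) binomid indices: those that are not the sum of two
nonzero binomid indices. -/
def Atom : Set (ℕ → ℕ) :=
  {η | IsBinomid η ∧ η ≠ 0 ∧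
    ¬ ∃ η₁ η₂ : ℕ → ℕ, IsBinomid η₁ ∧ IsBinomid η₂ ∧ η₁ ≠ 0 ∧ η₂ ≠ 0 ∧ η = η₁ + η₂}

/-- `A` is a basis of the commutative monoid `M`: it spans `M`, and whenever
`β_j = ∑ m_i β_i` for a finite sequence of distinct elements `β_i` of `A` and nonnegative
integers `m_i`, then `m_j ≥ 1`. -/
def IsMonoidBasis {N : Type*} [AddCommMonoid N] (M : AddSubmonoid N) (A : Set N) : Prop :=
  AddSubmonoid.closure A = M ∧
    ∀ (n : ℕ) (β : Fin n → N) (c : Fin n → ℕ), Function.Injective β → (∀ i, β i ∈ A) →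
      ∀ j : Fin n, β j = ∑ i, c i • β i → 1 ≤ c j

/-- The monoid `⟨L_k(𝕀_k)⟩` generated by the lex-minimal extensions of the finite binomid
indices of length `k`. -/
noncomputable def lexMinMonoid (k : ℕ) : AddSubmonoid (ℕ → ℕ) :=
  AddSubmonoid.closure (Set.range (lexMin k))

end Binomid

namespace Binomid

open Finset

/-! In terms of partial sums `s`, a binomid index is a superadditive sequence, and for k ≥ 1 the
image of `lexMin k` consists of those for which every s(n), n > k, equals some s(i) + s(n - i)
(`mem_range_lexMin_iff`). Past k², one split works for all n: s(n) = s(p) + s(n - p), where p ≤ k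
has maximal average s(p)/p (`IsTight.exists_period`). Hence finitely many splitting patterns
suffice. The indices obeying a fixed pattern form a monoid in which finitely many defects s(i+j) -
s(i) - s(j) and initial sums decide divisibility, so it embeds in some ℕ^ι as a subtractive, hence
finitely generated, submonoid (`splitMonoid_fg`). Summands of tight indices are tight, so induction
on s(k) writes each as a sum of atoms; an atom lies in every generating set, which gives uniqueness
and finiteness of the basis. -/

/-- The partial sums `e_1 + ⋯ + e_n` of a sequence. -/
def psum (η : ℕ → ℕ) (n : ℕ) : ℕ := ∑ i ∈ range n, η i

@[simp] theorem psum_zero (η : ℕ → ℕ) : psum η 0 = 0 := by simp [psum]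

theorem psum_succ (η : ℕ → ℕ) (n : ℕ) : psum η (n + 1) = psum η n + η n :=
  sum_range_succ η n

@[simp] theorem zero_psum (n : ℕ) : psum 0 n = 0 := by simp [psum]

theorem psum_add (η θ : ℕ → ℕ) (n : ℕ) : psum (η + θ) n = psum η n + psum θ n := by
  simp [psum, sum_add_distrib]

theorem psum_mono (η : ℕ → ℕ) : Monotone (psum η) :=
  monotone_nat_of_le_succ fun n => by rw [psum_succ]; omega

theorem psum_tsub {f : ℕ → ℕ} (hf : Monotone f) (h0 : f 0 = 0) (n : ℕ) :
    psum (fun i => f (i + 1) - f i) n = f n := by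
  rw [psum, sum_range_tsub hf, h0, Nat.sub_zero]

theorem isBinomid_iff {η : ℕ → ℕ} :
    IsBinomid η ↔ ∀ i j, psum η i + psum η j ≤ psum η (i + j) := by
  refine ⟨fun h i j => ?_, fun h k n _ hkn => ?_⟩
  · rcases Nat.eq_zero_or_pos j with rfl | hj
    · simp
    · exact h.add_le hj
  · have h1 := sum_range_add_sum_Ico η (by omega : n - k ≤ n)
    have h2 := h (n - k) k
    rw [Nat.sub_add_cancel hkn] at h2
    simp only [psum] at h2
    omega

theorem isBinomid_zero : IsBinomid 0 := isBinomid_iff.2 fun i j => by simp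

theorem IsBinomid.add {η θ : ℕ → ℕ} (hη : IsBinomid η) (hθ : IsBinomid θ) :
    IsBinomid (η + θ) := by
  rw [isBinomid_iff] at *
  intro i j
  have := hη i j
  have := hθ i j
  simp only [psum_add]
  omega

theorem IsBinomid.mul_le {η : ℕ → ℕ} (hη : IsBinomid η) (t p : ℕ) :
    t * psum η p ≤ psum η (t * p) := by
  induction t with
  | zero => simp
  | succ t ih =>
    have := isBinomid_iff.1 hη (t * p) p
    rw [Nat.succ_mul, Nat.succ_mul]
    omega

theorem sum_filter_trunc {m n : ℕ} (η : ℕ → ℕ) (h : n ≤ m) :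
    ∑ i : Fin m with i.val < n, trunc m η i = psum η n := by
  refine sum_bij (fun a _ => a.val) ?_ ?_ ?_ ?_
  · intro a ha; simpa using ha
  · intro a _ b _ hab; exact Fin.ext hab
  · intro b hb
    rw [mem_range] at hb
    exact ⟨⟨b, by omega⟩, by simpa using hb, rfl⟩
  · intro a _; rfl

theorem IsBinomid.trunc_mem {η : ℕ → ℕ} (hη : IsBinomid η) (m : ℕ) :
    trunc m η ∈ finiteIndices m := by
  intro k n hk hkn hnm
  rw [sum_filter_trunc η (hkn.trans hnm)]
  refine (hη k n hk hkn).trans (le_of_eq ?_)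
  symm
  refine sum_bij (fun a _ => a.val) ?_ ?_ ?_ ?_
  · intro a ha; simpa using ha
  · intro a _ b _ hab; exact Fin.ext hab
  · intro b hb
    rw [mem_Ico] at hb
    exact ⟨⟨b, by omega⟩, by simpa using hb, rfl⟩
  · intro a _; rfl

/-! ### Tight indices and the image of `lexMin` -/

/-- Binomid indices whose partial sums split nontrivially at every `n > k`. -/
def IsTight (k : ℕ) (η : ℕ → ℕ) : Prop :=
  IsBinomid η ∧ ∀ n, k < n → ∃ i, 0 < i ∧ i < n ∧ psum η n = psum η i + psum η (n - i)

/-- At the first difference, the split of `η` uses only earlier sums, shared with `θ`;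
superadditivity of `θ` then forbids a smaller term. -/
theorem IsTight.isLexMinExtension {k : ℕ} {η : ℕ → ℕ} (h : IsTight k η) :
    IsLexMinExtension (trunc k η) η := by
  refine ⟨h.1, rfl, fun θ hθ hθt => ?_⟩
  by_contra hlt
  rw [not_le] at hlt
  obtain ⟨n, hn1, hn2⟩ := hlt
  change ∀ j, j < n → θ j = η j at hn1
  change θ n < η n at hn2
  have hs : ∀ j, j ≤ n → psum θ j = psum η j := fun j hj =>
    sum_congr rfl fun i hi => hn1 i (by rw [mem_range] at hi; omega)
  have hkn : k ≤ n := by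
    by_contra hnk
    exact hn2.ne (congrFun hθt ⟨n, by omega⟩)
  obtain ⟨i, hi, hin, he⟩ := h.2 (n + 1) (by omega)
  have h1 := isBinomid_iff.1 hθ i (n + 1 - i)
  rw [show i + (n + 1 - i) = n + 1 by omega, hs i (by omega), hs (n + 1 - i) (by omega), ← he,
    psum_succ, psum_succ, hs n le_rfl] at h1
  omega

theorem isTight_extSum {k : ℕ} (hk : 1 ≤ k) {ζ : Fin k → ℕ} (hζ : ζ ∈ finiteIndices k) :
    IsTight k (fun n => extSum ζ (n + 1) - extSum ζ n) := by
  have hmono : Monotone (extSum ζ) := monotone_nat_of_le_succ fun n =>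
    le_trans (Nat.le_add_right _ _) (extSum_add hζ n 1)
  have hsum := psum_tsub hmono (extSum_zero ζ)
  refine ⟨isBinomid_iff.2 fun i j => ?_, fun n hn => ?_⟩
  · simp only [hsum]
    exact extSum_add hζ i j
  · simp only [hsum]
    by_contra! hne
    have hlt : ∀ i, 0 < i → i < n → extSum ζ i + extSum ζ (n - i) < extSum ζ n := by
      intro i hi hin
      have h1 := extSum_add hζ i (n - i)
      rw [show i + (n - i) = n by omega] at h1
      exact lt_of_le_of_ne h1 (hne i hi hin).symm
    have h1 := extSum_le ζ (b := extSum ζ n - 1) hn fun i hi hin => by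
      have := hlt i hi hin
      omega
    -- Here k ≥ 1 gives n ≥ 2, so a split exists and `extSum ζ n` is positive: the bound `extSum ζ n
    -- - 1` is not truncated.
    have := hlt 1 one_pos (by omega)
    omega

theorem trunc_extSum {k : ℕ} (ζ : Fin k → ℕ) :
    trunc k (fun n => extSum ζ (n + 1) - extSum ζ n) = ζ := by
  funext a
  change extSum ζ (a.val + 1) - extSum ζ a.val = ζ a
  have ha := a.isLt
  rw [extSum_of_le ζ (by omega : a.val + 1 ≤ k), extSum_of_le ζ (by omega : a.val ≤ k)]
  have h1 : (univ.filter fun i : Fin k => i.val < a.val + 1) =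
      insert a (univ.filter fun i : Fin k => i.val < a.val) := by
    ext i
    simp only [mem_filter, mem_univ, true_and, mem_insert, Fin.ext_iff]
    omega
  rw [h1, sum_insert (by simp)]
  omega

theorem mem_range_lexMin_iff {k : ℕ} (hk : 1 ≤ k) {η : ℕ → ℕ} :
    η ∈ Set.range (lexMin k) ↔ IsTight k η := by
  constructor
  · rintro ⟨ζ, rfl⟩
    have h := isTight_extSum hk ζ.2
    have h1 := h.isLexMinExtension
    rw [trunc_extSum] at h1
    rwa [(lexMin_spec k ζ).unique h1]
  · intro h
    exact ⟨⟨_, h.1.trunc_mem k⟩, (lexMin_spec k _).unique h.isLexMinExtension⟩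

theorem IsTight.eq_zero {k : ℕ} {η : ℕ → ℕ} (h : IsTight k η) (h0 : psum η k = 0) : η = 0 := by
  have hs : ∀ n, psum η n = 0 := by
    intro n
    induction n using Nat.strong_induction_on with
    | _ n ih =>
      by_cases hn : n ≤ k
      · exact Nat.le_zero.1 (h0 ▸ psum_mono η hn)
      · obtain ⟨i, hi, hin, he⟩ := h.2 n (by omega)
        rw [he, ih i hin, ih (n - i) (by omega)]
  funext n
  have := psum_succ η n
  rw [hs, hs] at this
  simpa using this.symm

/-- Equality in a sum of two superadditivity inequalities forces equality in each. -/
theorem IsTight.of_add {k : ℕ} {η θ : ℕ → ℕ} (h : IsTight k (η + θ)) (hη : IsBinomid η)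
    (hθ : IsBinomid θ) : IsTight k η := by
  refine ⟨hη, fun n hn => ?_⟩
  obtain ⟨i, hi, hin, he⟩ := h.2 n hn
  refine ⟨i, hi, hin, ?_⟩
  have h1 := isBinomid_iff.1 hη i (n - i)
  have h2 := isBinomid_iff.1 hθ i (n - i)
  rw [show i + (n - i) = n by omega] at h1 h2
  simp only [psum_add] at he
  omega

/-! ### Eventual periodicity of the splits -/

/-- If the piece i exceeds k, split it recursively, keep its short part and merge the remainder with
n - i; superadditivity makes the merge lossless. -/
theorem IsTight.exists_step {k : ℕ} {η : ℕ → ℕ} (h : IsTight k η) {n : ℕ}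
    (hn : k < n) : ∃ m, m < n ∧ n ≤ m + k ∧ psum η n = psum η m + psum η (n - m) := by
  induction n using Nat.strong_induction_on with
  | _ n ih =>
    obtain ⟨i, hi, hin, he⟩ := h.2 n hn
    by_cases hik : i ≤ k
    · exact ⟨n - i, by omega, by omega, by rw [he, Nat.sub_sub_self hin.le, add_comm]⟩
    obtain ⟨m, hm1, hm2, hm⟩ := ih i hin (by omega)
    refine ⟨m + (n - i), by omega, by omega, ?_⟩
    have h1 := isBinomid_iff.1 h.1 m (n - i)
    have h2 := isBinomid_iff.1 h.1 (m + (n - i)) (i - m)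
    rw [show m + (n - i) + (i - m) = n by omega] at h2
    rw [show n - (m + (n - i)) = i - m by omega]
    omega

/-- A period: the length of an initial segment of maximal average. -/
theorem exists_max_average {k : ℕ} (hk : 1 ≤ k) (s : ℕ → ℕ) :
    ∃ p, 1 ≤ p ∧ p ≤ k ∧ ∀ d, 1 ≤ d → d ≤ k → p * s d ≤ d * s p := by
  obtain ⟨p, hp, hmax⟩ := exists_max_image (Icc 1 k) (fun d => (s d : ℚ) / d)
    ⟨1, by simp [hk]⟩
  rw [mem_Icc] at hp
  refine ⟨p, hp.1, hp.2, fun d hd hdk => ?_⟩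
  have h1 := hmax d (by simp [hd, hdk])
  rw [div_le_div_iff₀ (by exact_mod_cast hd) (by exact_mod_cast hp.1)] at h1
  have h2 : s d * p ≤ s p * d := by exact_mod_cast h1
  linarith

/-- Peel p pieces of length at most k off n. Some consecutive pieces have total length divisible by
p; by maximality of the average they can be replaced by copies of p, one of which is then removed.
-/
theorem IsTight.exists_period {k : ℕ} (hk : 1 ≤ k) {η : ℕ → ℕ} (h : IsTight k η) :
    ∃ p, 1 ≤ p ∧ p ≤ k ∧ ∀ n, k * k < n → psum η n = psum η p + psum η (n - p) := by
  obtain ⟨p, hp1, hpk, hp⟩ := exists_max_average hk (psum η)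
  refine ⟨p, hp1, hpk, fun n hn => ?_⟩
  have hadd := isBinomid_iff.1 h.1
  have hpn : p ≤ n := by nlinarith
  refine le_antisymm ?_ (by simpa [Nat.add_sub_cancel' hpn] using hadd p (n - p))
  have hg : ∀ m, ∃ m', k < m → m' < m ∧ m ≤ m' + k ∧ psum η m = psum η m' + psum η (m - m') := by
    intro m
    by_cases hm : k < m
    · obtain ⟨m', hm'⟩ := h.exists_step hm
      exact ⟨m', fun _ => hm'⟩
    · exact ⟨0, fun h => absurd h hm⟩
  choose g hg using hg
  set u : ℕ → ℕ := fun j => g^[j] n with hu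
  have husucc : ∀ j, u (j + 1) = g (u j) := fun j => Function.iterate_succ_apply' g j n
  have hlow : ∀ j, j ≤ p → n ≤ u j + k * j := by
    intro j
    induction j with
    | zero => intro _; simp [hu]
    | succ j ih =>
      intro hj
      have h1 := ih (by omega)
      have h2 : k * (j + 1) ≤ k * k := Nat.mul_le_mul_left k (by omega)
      rw [Nat.mul_succ] at h2 ⊢
      have h3 := (hg (u j) (by omega)).2.1
      rw [← husucc] at h3
      omega
  have hstep : ∀ j, j < p → u (j + 1) < u j ∧ u j ≤ u (j + 1) + k ∧
      psum η (u j) = psum η (u (j + 1)) + psum η (u j - u (j + 1)) := by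
    intro j hj
    have h1 := hlow j hj.le
    have h2 : k * (j + 1) ≤ k * k := Nat.mul_le_mul_left k (by omega)
    rw [Nat.mul_succ] at h2
    rw [husucc]
    exact hg (u j) (by omega)
  have hsplit : ∀ j, j ≤ p → u j ≤ n ∧ psum η n ≤ psum η (u j) + psum η (n - u j) := by
    intro j
    induction j with
    | zero => intro _; simp [hu]
    | succ j ih =>
      intro hj
      obtain ⟨h1, h2⟩ := ih (by omega)
      obtain ⟨h3, h4, h5⟩ := hstep j (by omega)
      refine ⟨by omega, ?_⟩
      have h6 := hadd (n - u j) (u j - u (j + 1))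
      rw [show n - u j + (u j - u (j + 1)) = n - u (j + 1) by omega] at h6
      omega
  -- The pieces between `u (i + d)` and `u i` have average at most that of p.
  have hslope : ∀ i d, i + d ≤ p → u (i + d) ≤ u i ∧ (d ≠ 0 → u (i + d) < u i) ∧
      p * psum η (u i) ≤ p * psum η (u (i + d)) + (u i - u (i + d)) * psum η p := by
    intro i d
    induction d with
    | zero => intro _; simp
    | succ d ih =>
      intro hd
      obtain ⟨h1, -, h2⟩ := ih (by omega)
      obtain ⟨h3, h4, h5⟩ := hstep (i + d) (by omega)
      have h6 := hp (u (i + d) - u (i + d + 1)) (by omega) (by omega)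
      rw [← add_assoc]
      refine ⟨by omega, fun _ => by omega, ?_⟩
      rw [show u i - u (i + d + 1) = (u i - u (i + d)) + (u (i + d) - u (i + d + 1)) by omega,
        add_mul]
      rw [h5, mul_add] at h2
      omega
  -- Pigeonhole: p + 1 points, p residues.
  have hpig : ∃ i d, d ≠ 0 ∧ i + d ≤ p ∧ u (i + d) % p = u i % p := by
    obtain ⟨a, ha, b, hb, hab, he⟩ := exists_ne_map_eq_of_card_lt_of_maps_to
      (s := range (p + 1)) (t := range p) (f := fun j => u j % p) (by simp)
      (fun j _ => by simpa using Nat.mod_lt _ hp1)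
    rw [mem_range] at ha hb
    rcases lt_or_gt_of_ne hab with hlt | hlt
    · exact ⟨a, b - a, by omega, by omega, by rw [Nat.add_sub_cancel' hlt.le]; exact he.symm⟩
    · exact ⟨b, a - b, by omega, by omega, by rw [Nat.add_sub_cancel' hlt.le]; exact he⟩
  obtain ⟨i, d, hd0, hd, hmod⟩ := hpig
  obtain ⟨h1, h2, h3⟩ := hslope i d hd
  have h2 := h2 hd0
  obtain ⟨t, ht⟩ := (Nat.modEq_iff_dvd' h1).1 hmod
  obtain ⟨t, rfl⟩ : ∃ t', t = t' + 1 := Nat.exists_eq_succ_of_ne_zero (by rintro rfl; omega)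
  rw [ht, mul_assoc, ← mul_add] at h3
  have h4 := le_of_mul_le_mul_left h3 hp1
  have h5 := h.1.mul_le t p
  have h6 := hadd (u (i + d)) (t * p)
  have h7 : u i - p = u (i + d) + t * p := by
    rw [mul_add, mul_comm p t] at ht
    omega
  have h8 : p ≤ u i := by
    rw [mul_add, mul_comm p t] at ht
    omega
  rw [← h7] at h6
  obtain ⟨h9, h10⟩ := hsplit i (by omega)
  have h11 := hadd (u i - p) (n - u i)
  rw [show u i - p + (n - u i) = n - p by omega] at h11
  rw [add_mul, one_mul] at h4
  omega

/-! ### Finite generation -/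

/-- A submonoid with an additive map to some `ℕ^ι` that is trivial only at `0` and reflects
divisibility is finitely generated. -/
theorem fg_of_reflects_le {A ι : Type*} [AddCommMonoid A] [Finite ι] (C : AddSubmonoid A)
    (f : A → ι → ℕ) (hf0 : f 0 = 0) (hadd : ∀ x ∈ C, ∀ y ∈ C, f (x + y) = f x + f y)
    (hzero : ∀ x ∈ C, f x = 0 → x = 0)
    (hle : ∀ x ∈ C, ∀ y ∈ C, f x ≤ f y → ∃ z ∈ C, y = x + z) : C.FG := by
  let g : C →+ (ι → ℕ) :=
    { toFun := fun x => f x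
      map_zero' := hf0
      map_add' := fun x y => hadd x x.2 y y.2 }
  have hinj : Function.Injective g := by
    intro x y hxy
    have hxy' : f x = f y := hxy
    obtain ⟨z, hz, hxz⟩ := hle x x.2 y y.2 hxy'.le
    have h1 := hadd x x.2 z hz
    rw [← hxz, hxy', left_eq_add] at h1
    rw [hzero z hz h1, add_zero] at hxz
    exact Subtype.ext hxz.symm
  have hrange : (AddMonoidHom.mrange g).FG := by
    refine AddSubmonoid.fg_of_subtractive ?_
    rintro _ ⟨x, rfl⟩ v ⟨y, hy⟩
    have hy' : f y = f x + v := hy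
    obtain ⟨z, hz, hyz⟩ := hle x x.2 y y.2 (by rw [hy']; exact le_self_add)
    refine ⟨⟨z, hz⟩, ?_⟩
    have h1 := hadd x x.2 z hz
    rw [← hyz, hy'] at h1
    exact (add_left_cancel h1).symm
  have htop : (⊤ : AddSubmonoid C).FG := by
    refine AddSubmonoid.FG.map_injective g hinj ?_
    rwa [← AddMonoidHom.mrange_eq_map]
  exact (AddMonoid.fg_iff_addSubmonoid_fg C).1 ⟨htop⟩

/-- The binomid indices whose partial sums split at every `n > k` into the pieces `c n`
and `n - c n`. -/
def splitMonoid (k : ℕ) (c : ℕ → ℕ) : AddSubmonoid (ℕ → ℕ) where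
  carrier := {η | IsBinomid η ∧ ∀ n, k < n → psum η n = psum η (c n) + psum η (n - c n)}
  zero_mem' := ⟨isBinomid_zero, fun n _ => by simp⟩
  add_mem' := by
    rintro η θ ⟨h1, h2⟩ ⟨h3, h4⟩
    refine ⟨h1.add h3, fun n hn => ?_⟩
    simp only [psum_add, h2 n hn, h4 n hn]
    omega

theorem isTight_of_mem_splitMonoid {k : ℕ} {c : ℕ → ℕ} (hc : ∀ n, k < n → 0 < c n ∧ c n < n)
    {η : ℕ → ℕ} (h : η ∈ splitMonoid k c) : IsTight k η :=
  ⟨h.1, fun n hn => ⟨c n, (hc n hn).1, (hc n hn).2, h.2 n hn⟩⟩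

/-- Differences of elements of `splitMonoid k c` with `c` eventually constant are superadditive
as soon as they are superadditive on an initial segment. -/
theorem splitMonoid_superadditive_sub {k M p : ℕ} {c : ℕ → ℕ} (hkM : k ≤ M) (hp : 1 ≤ p)
    (hpM : p ≤ M) (hcp : ∀ n, M < n → c n = p) {η θ : ℕ → ℕ} (hη : η ∈ splitMonoid k c)
    (hθ : θ ∈ splitMonoid k c)
    (hle : ∀ i j, i ≤ M → j ≤ M → psum η (i + j) + psum θ i + psum θ j ≤
      psum θ (i + j) + psum η i + psum η j) (n : ℕ) :
    ∀ i j, i + j = n → psum η (i + j) + psum θ i + psum θ j ≤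
      psum θ (i + j) + psum η i + psum η j := by
  have hper : ∀ ξ ∈ splitMonoid k c, ∀ n, M < n → psum ξ n = psum ξ p + psum ξ (n - p) := by
    intro ξ hξ n hn
    have := hξ.2 n (by omega)
    rwa [hcp n hn] at this
  induction n using Nat.strong_induction_on with
  | _ n ih =>
    -- Replacing i by i - p lowers the sums at i and i + j by the same `psum · p`, so the defects do
    -- not change.
    have key : ∀ i j, i + j = n → M < i → psum η (i + j) + psum θ i + psum θ j ≤
        psum θ (i + j) + psum η i + psum η j := by
      intro i j hij hi
      have h1 := ih (n - p) (by omega) (i - p) j (by omega)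
      rw [hper η hη (i + j) (by omega), hper θ hθ (i + j) (by omega), hper η hη i hi,
        hper θ hθ i hi, show i + j - p = i - p + j by omega]
      omega
    intro i j hij
    by_cases hi : M < i
    · exact key i j hij hi
    by_cases hj : M < j
    · have := key j i (by omega) hj
      rw [add_comm i j]
      omega
    · exact hle i j (by omega) (by omega)

/-- The defects with i, j ≤ M control superadditivity of a difference; the sums up to k detect zero
and compare first terms. -/
theorem splitMonoid_fg {k M p : ℕ} (hk : 1 ≤ k) {c : ℕ → ℕ} (hkM : k ≤ M) (hp : 1 ≤ p)
    (hpM : p ≤ M) (hc : ∀ n, k < n → 0 < c n ∧ c n < n) (hcp : ∀ n, M < n → c n = p) :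
    (splitMonoid k c).FG := by
  refine fg_of_reflects_le (splitMonoid k c)
    (ι := (Fin (M + 1) × Fin (M + 1)) ⊕ Fin (k + 1))
    (fun η => Sum.elim (fun x => psum η (x.1 + x.2) - (psum η x.1 + psum η x.2))
      (fun i => psum η i)) ?_ ?_ ?_ ?_
  · funext x
    rcases x with x | x <;> simp
  · intro η hη θ hθ
    funext x
    rcases x with x | x
    · have h1 := isBinomid_iff.1 hη.1 x.1 x.2
      have h2 := isBinomid_iff.1 hθ.1 x.1 x.2
      simp only [Sum.elim_inl, Pi.add_apply, psum_add]
      omega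
    · simp [psum_add]
  · intro η hη h0
    have h1 := congrFun h0 (Sum.inr (Fin.last k))
    exact (isTight_of_mem_splitMonoid hc hη).eq_zero (by simpa using h1)
  · intro η hη θ hθ hle
    have hsup := splitMonoid_superadditive_sub hkM hp hpM hcp hη hθ fun i j hi hj => by
      have h1 := hle (Sum.inl (⟨i, by omega⟩, ⟨j, by omega⟩))
      simp only [Sum.elim_inl] at h1
      have h2 := isBinomid_iff.1 hη.1 i j
      have h3 := isBinomid_iff.1 hθ.1 i j
      omega
    have h1 : psum η 1 ≤ psum θ 1 := by
      have h1 := hle (Sum.inr ⟨1, by omega⟩)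
      simpa using h1
    -- A term is the defect at (n, 1) plus the first term.
    have hpt : ∀ n, η n ≤ θ n := by
      intro n
      have h2 := hsup (n + 1) n 1 rfl
      rw [psum_succ η n, psum_succ θ n] at h2
      omega
    have hθe : θ = η + (θ - η) := by
      funext n
      have := hpt n
      simp only [Pi.add_apply, Pi.sub_apply]
      omega
    have hs : ∀ n, psum θ n = psum η n + psum (θ - η) n := fun n => by
      conv_lhs => rw [hθe]
      exact psum_add _ _ n
    refine ⟨θ - η, ⟨isBinomid_iff.2 fun i j => ?_, fun n hn => ?_⟩, hθe⟩
    · have h2 := hsup (i + j) i j rfl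
      simp only [hs] at h2
      omega
    · have h2 := hη.2 n hn
      have h3 := hθ.2 n hn
      simp only [hs] at h3
      omega

/-- The ways of splitting every `n > k` that are constant, with value at most `k`, past `k * k`. -/
def splittings (k : ℕ) : Set (ℕ → ℕ) :=
  {c | (∀ n, c n ≤ k * k) ∧ (∀ n, k < n → 0 < c n ∧ c n < n) ∧
    ∃ p, 1 ≤ p ∧ p ≤ k ∧ ∀ n, k * k < n → c n = p}

theorem splittings_finite (k : ℕ) : (splittings k).Finite := by
  -- The last retained value, at k * k + 1, reveals the eventual constant.
  have hinj : Set.InjOn (fun (c : ℕ → ℕ) (i : Fin (k * k + 2)) => c i) (splittings k) := by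
    rintro c ⟨-, -, p, -, -, hp⟩ c' ⟨-, -, p', -, -, hp'⟩ h
    have hval : ∀ i, i < k * k + 2 → c i = c' i := fun i hi => congrFun h ⟨i, hi⟩
    funext n
    by_cases hn : k * k < n
    · have h1 := hval (k * k + 1) (by omega)
      rw [hp _ (by omega), hp' _ (by omega)] at h1
      rw [hp n hn, hp' n hn, h1]
    · exact hval n (by omega)
  refine Set.Finite.of_finite_image ?_ hinj
  refine (Set.finite_Iic (fun _ : Fin (k * k + 2) => k * k)).subset ?_
  rintro _ ⟨c, hc, rfl⟩
  exact fun i => hc.1 i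

theorem IsTight.exists_mem_splitMonoid {k : ℕ} (hk : 1 ≤ k) {η : ℕ → ℕ} (h : IsTight k η) :
    ∃ c ∈ splittings k, η ∈ splitMonoid k c := by
  obtain ⟨p, hp1, hpk, hp⟩ := h.exists_period hk
  have hkk : k ≤ k * k := Nat.le_mul_self k
  choose! g hg using h.2
  refine ⟨fun n => if k * k < n then p else if k < n then g n else 0,
    ⟨fun n => ?_, fun n hn => ?_, p, hp1, hpk, fun n hn => if_pos hn⟩, h.1, fun n hn => ?_⟩
  · dsimp only
    split_ifs with h1 h2
    · omega
    · have := hg n h2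
      omega
    · omega
  · dsimp only
    split_ifs with h1
    · omega
    · exact ⟨(hg n hn).1, (hg n hn).2.1⟩
  · dsimp only
    split_ifs with h1
    · exact hp n h1
    · exact (hg n hn).2.2

theorem lexMinMonoid_fg {k : ℕ} (hk : 1 ≤ k) : (lexMinMonoid k).FG := by
  have heq : lexMinMonoid k = ⨆ c ∈ splittings k, splitMonoid k c := by
    refine le_antisymm (AddSubmonoid.closure_le.2 fun η hη => ?_)
      (iSup₂_le fun c hc η hη => AddSubmonoid.subset_closure ?_)
    · obtain ⟨c, hc, hηc⟩ := ((mem_range_lexMin_iff hk).1 hη).exists_mem_splitMonoid hk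
      exact (le_iSup₂ (f := fun c _ => splitMonoid k c) c hc) hηc
    · exact (mem_range_lexMin_iff hk).2 (isTight_of_mem_splitMonoid hc.2.1 hη)
  rw [heq]
  refine AddSubmonoid.FG.biSup (splittings_finite k) _ ?_
  rintro c ⟨-, hc, p, hp1, hpk, hcp⟩
  have hkk : k ≤ k * k := Nat.le_mul_self k
  exact splitMonoid_fg hk hkk hp1 (hpk.trans hkk) hc hcp

/-! ### Atoms and bases -/

theorem isBinomid_of_mem_closure {S : Set (ℕ → ℕ)} (hS : ∀ η ∈ S, IsBinomid η) {η : ℕ → ℕ}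
    (h : η ∈ AddSubmonoid.closure S) : IsBinomid η := by
  induction h using AddSubmonoid.closure_induction with
  | mem x hx => exact hS x hx
  | zero => exact isBinomid_zero
  | add x y _ _ hx hy => exact hx.add hy

theorem isBinomid_of_mem_lexMinMonoid {k : ℕ} {η : ℕ → ℕ} (h : η ∈ lexMinMonoid k) :
    IsBinomid η := by
  refine isBinomid_of_mem_closure ?_ h
  rintro _ ⟨ζ, rfl⟩
  exact (lexMin_spec k ζ).1

/-- An atom belongs to every set of binomid indices that generates it. -/
theorem mem_of_mem_atom_of_mem_closure {S : Set (ℕ → ℕ)} (hS : ∀ η ∈ S, IsBinomid η)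
    {α : ℕ → ℕ} (hα : α ∈ Atom) (h : α ∈ AddSubmonoid.closure S) : α ∈ S := by
  induction h using AddSubmonoid.closure_induction with
  | mem x hx => exact hx
  | zero => exact absurd rfl hα.2.1
  | add x y hx hy ihx ihy =>
    by_cases hx0 : x = 0
    · rw [hx0, zero_add] at hα ⊢
      exact ihy hα
    by_cases hy0 : y = 0
    · rw [hy0, add_zero] at hα ⊢
      exact ihx hα
    exact absurd ⟨x, y, isBinomid_of_mem_closure hS hx, isBinomid_of_mem_closure hS hy, hx0, hy0,
      rfl⟩ hα.2.2

theorem IsTight.mem_closure_atom {k : ℕ} (hk : 1 ≤ k) {η : ℕ → ℕ} (h : IsTight k η) :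
    η ∈ AddSubmonoid.closure (Atom ∩ Set.range (lexMin k)) := by
  induction hs : psum η k using Nat.strong_induction_on generalizing η with
  | _ s ih =>
    by_cases h0 : η = 0
    · rw [h0]
      exact zero_mem _
    by_cases hat : ∃ η₁ η₂ : ℕ → ℕ, IsBinomid η₁ ∧ IsBinomid η₂ ∧ η₁ ≠ 0 ∧ η₂ ≠ 0 ∧ η = η₁ + η₂
    · obtain ⟨η₁, η₂, h1, h2, h10, h20, rfl⟩ := hat
      have t1 := h.of_add h1 h2
      have t2 := (add_comm η₁ η₂ ▸ h).of_add h2 h1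
      have p1 : psum η₁ k ≠ 0 := fun h => h10 (t1.eq_zero h)
      have p2 : psum η₂ k ≠ 0 := fun h => h20 (t2.eq_zero h)
      rw [psum_add] at hs
      exact add_mem (ih _ (by omega) t1 rfl) (ih _ (by omega) t2 rfl)
    · exact AddSubmonoid.subset_closure ⟨⟨h.1, h0, hat⟩, (mem_range_lexMin_iff hk).2 h⟩

theorem closure_atom_inter_range {k : ℕ} (hk : 1 ≤ k) :
    AddSubmonoid.closure (Atom ∩ Set.range (lexMin k)) = lexMinMonoid k :=
  le_antisymm (AddSubmonoid.closure_mono Set.inter_subset_right)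
    (AddSubmonoid.closure_le.2 fun _ h => ((mem_range_lexMin_iff hk).1 h).mem_closure_atom hk)

theorem isMonoidBasis_atom {k : ℕ} (hk : 1 ≤ k) :
    IsMonoidBasis (lexMinMonoid k) (Atom ∩ Set.range (lexMin k)) := by
  refine ⟨closure_atom_inter_range hk, fun n β c hβ hA j hj => ?_⟩
  by_contra! hc
  -- With `c j = 0` the atom `β j` is generated by the others, hence is one of them.
  have hmem : β j ∈ AddSubmonoid.closure (β '' {i | i ≠ j}) := by
    rw [hj]
    refine sum_mem fun i _ => ?_
    by_cases hij : i = j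
    · rw [hij, Nat.lt_one_iff.1 hc, zero_smul]
      exact zero_mem _
    · exact nsmul_mem (AddSubmonoid.subset_closure (Set.mem_image_of_mem β hij)) _
  obtain ⟨i, hij, he⟩ := mem_of_mem_atom_of_mem_closure
    (by rintro _ ⟨i, -, rfl⟩; exact (hA i).1.1) (hA j).1 hmem
  exact hij (hβ he)

/-- A basis is contained in every generating subset of it. -/
theorem IsMonoidBasis.subset_of_generates {N : Type*} [AddCommMonoid N] {M : AddSubmonoid N}
    {A B : Set N} (hB : IsMonoidBasis M B) (hAB : A ⊆ B) (hA : AddSubmonoid.closure A = M) :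
    B ⊆ A := by
  intro b hb
  by_contra hbA
  have hbM : b ∈ AddSubmonoid.closure A := by
    rw [hA, ← hB.1]
    exact AddSubmonoid.subset_closure hb
  obtain ⟨f, t, ht, -, hsum⟩ := AddSubmonoid.mem_closure_iff_exists_finset_subset.1 hbM
  have hbt : b ∉ t := fun h => hbA (ht h)
  let e : Fin t.card ≃ t := t.equivFin.symm
  -- List b first with coefficient 0, against the basis condition.
  have hone := hB.2 (t.card + 1) (Fin.cons b fun i => (e i : N)) (Fin.cons 0 fun i => f (e i))
    ?_ ?_ 0 ?_
  · simp at hone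
  · refine Fin.cons_injective_iff.2 ⟨?_, Subtype.val_injective.comp e.injective⟩
    rintro ⟨i, hi⟩
    exact hbt (hi ▸ (e i).2)
  · exact Fin.cases hb fun i => hAB (ht (e i).2)
  · rw [Fin.sum_univ_succ]
    simp only [Fin.cons_zero, Fin.cons_succ, zero_smul, zero_add]
    rw [e.sum_comp fun a : t => f a • (a : N), sum_coe_sort t fun a => f a • a, hsum]

end Binomid

theorem mainTheorem6 (k : ℕ) (hk : 1 ≤ k) :
    (Binomid.lexMinMonoid k).FG ∧
    Binomid.IsMonoidBasis (Binomid.lexMinMonoid k)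
      (Binomid.Atom ∩ Set.range (Binomid.lexMin k)) ∧
    (∀ B : Set (ℕ → ℕ), Binomid.IsMonoidBasis (Binomid.lexMinMonoid k) B →
      B = Binomid.Atom ∩ Set.range (Binomid.lexMin k)) ∧
    (Binomid.Atom ∩ Set.range (Binomid.lexMin k)).Finite := by
  have hfg := Binomid.lexMinMonoid_fg hk
  have hmem : ∀ B : Set (ℕ → ℕ), AddSubmonoid.closure B = Binomid.lexMinMonoid k →
      Binomid.Atom ∩ Set.range (Binomid.lexMin k) ⊆ B := by
    rintro B hB η ⟨hη, hr⟩
    refine Binomid.mem_of_mem_atom_of_mem_closure (fun θ hθ => ?_) hη ?_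
    · refine Binomid.isBinomid_of_mem_lexMinMonoid (k := k) ?_
      rw [← hB]
      exact AddSubmonoid.subset_closure hθ
    · rw [hB]
      exact AddSubmonoid.subset_closure hr
  refine ⟨hfg, Binomid.isMonoidBasis_atom hk, fun B hB => ?_, ?_⟩
  · exact (hB.subset_of_generates (hmem B hB.1) (Binomid.closure_atom_inter_range hk)).antisymm
      (hmem B hB.1)
  · obtain ⟨F, hF⟩ := hfg
    exact F.finite_toSet.subset (hmem _ hF)
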